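/- Let $\mathbb D$ be the open unit disk in $\mathbb C$ and let $dA=\frac1\pi\,dx\,dy$ be the normalized Lebesgue area measure on $\mathbb D$. Let $1\le p<\infty$ and let $w:\mathbb D\to[0,\infty)$ be a (Lebesgue) measurable function that is integrable with respect to $dA$, radial, i.e. $w(z)=w(|z|)$ for all $z\in\mathbb D$, and satisfies $\int_{\mathbb D} w\,dA>0$ (equivalently, $w$ is positive on a set of positive measure). Let $A^p_w$ be the set of all holomorphic functions $f$ in $\mathbb D$ for which $$\|f\|_{p,w}=\left(\int_{\mathbb D}|f|^p\,w\,dA\right)^{1/p}<\infty .$$ Then the Korenblum domination principle holds for $A^p_w$; that is, there exists $c\in(0,1)$ such that for all $f,g\in A^p_w$ that satisfy $|f(z)|\le|g(z)|$ whenever $c\le|z|<1$, one has $\|f\|_{p,w}\le\|g\|_{p,w}$. -/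

import Mathlib

open MeasureTheory

noncomputable section

/-- Normalized Lebesgue area measure `dA = (1/π) dx dy` on the open unit disk, as a measure on `ℂ`. -/
def diskArea : Measure ℂ :=
  (ENNReal.ofReal Real.pi)⁻¹ • volume.restrict (Metric.ball (0 : ℂ) 1)

/-- A weight on the open unit disk: (Lebesgue) measurable and non-negative there, with
`∫ w dA > 0`. Only the values on the disk matter. Integrability is not part of the notion. -/
structure IsWeight (w : ℂ → ℝ) : Prop where
  aemeasurable : AEMeasurable w diskArea
  nonneg : ∀ z ∈ Metric.ball (0 : ℂ) 1, 0 ≤ w z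
  lintegral_pos : 0 < ∫⁻ z, ENNReal.ofReal (w z) ∂diskArea

/-- `w` is radial: `w z = w |z|` for all `z` in the open unit disk. -/
def IsRadial (w : ℂ → ℝ) : Prop :=
  ∀ z ∈ Metric.ball (0 : ℂ) 1, w z = w ((‖z‖ : ℝ) : ℂ)

/-- The weighted Bergman space `A^p_w`: the functions `f` that are holomorphic in the open unit
disk and satisfy `∫ |f|^p w dA < ∞`. Only the values of `f` on the disk matter. -/
def bergmanSpace (p : ℝ) (w : ℂ → ℝ) : Set (ℂ → ℂ) :=
  {f | DifferentiableOn ℂ f (Metric.ball (0 : ℂ) 1) ∧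
    Integrable (fun z => ‖f z‖ ^ p * w z) diskArea}

/-- `‖f‖_{p,w} = (∫ |f|^p w dA)^{1/p}`. -/
def bergmanNorm (p : ℝ) (w : ℂ → ℝ) (f : ℂ → ℂ) : ℝ :=
  (∫ z, ‖f z‖ ^ p * w z ∂diskArea) ^ (1 / p)

/-- `c ∈ (0,1)` is an admissible radius for `A^p_w`. -/
def IsAdmissibleRadius (p : ℝ) (w : ℂ → ℝ) (c : ℝ) : Prop :=
  0 < c ∧ c < 1 ∧
    ∀ f ∈ bergmanSpace p w, ∀ g ∈ bergmanSpace p w,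
      (∀ z : ℂ, c ≤ ‖z‖ → ‖z‖ < 1 → ‖f z‖ ≤ ‖g z‖) →
        bergmanNorm p w f ≤ bergmanNorm p w g

/-- The Korenblum domination principle holds for `A^p_w`. -/
def KorenblumPrinciple (p : ℝ) (w : ℂ → ℝ) : Prop :=
  ∃ c : ℝ, IsAdmissibleRadius p w c

end

open Set Filter Topology Metric

/-! The weight enters only through the finite rotation invariant measure `μ = w dA`, which does not
charge the origin. Fix an annulus `K = {a ≤ |z| ≤ b}` of positive mass. If `c ≤ a/2` and `g` is not
identically zero, then `F = f/g` extends holomorphically to `a/2 < |z| < 1` with `|F| ≤ 1`. Put `l =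
F(a)` and `δ = 1 - |l|`. A Harnack inequality with constant `C` gives both `|F - l| ≤ Cδ` and `1 -
|F| ≥ δ/(1+C)` on `K`.

Gain: `∫_K (|g|^p - |f|^p) dμ` is at least `δ/(1+C)` times `∫_K |g|^p dμ`. Loss: `F` may have poles
near the origin, but `f - l g` is holomorphic in the whole disk and at most `Cδ|g|` on `K`; mean
values over `K` carry this inward, so `|f|^p - |g|^p` is at most a constant times `δ` times the
average of `|g|^p` over `K`. Both sides are linear in `δ`, so it suffices that `|z| < c` has small
mass, uniformly in `f` and `g`. -/

/-- Tangent line inequality for the convex function `x ↦ x ^ p`. -/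
theorem rpow_sub_rpow_le_mul_sub {p a b : ℝ} (hp : 1 ≤ p) (ha : 0 ≤ a) (hb : 0 ≤ b) :
    a ^ p - b ^ p ≤ p * a ^ (p - 1) * (a - b) := by
  have hp0 : 0 < p := by linarith
  rcases ha.eq_or_lt with rfl | ha
  · rcases hp.eq_or_lt with rfl | hp1
    · simp
    · rw [Real.zero_rpow hp0.ne', Real.zero_rpow (by linarith)]
      have := Real.rpow_nonneg hb p
      linarith
  · have h := one_add_mul_self_le_rpow_one_add (s := b / a - 1) (by
      have : 0 ≤ b / a := by positivity
      linarith) hp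
    rw [add_sub_cancel, Real.div_rpow hb ha.le, le_div_iff₀ (by positivity)] at h
    have e : a ^ p = a ^ (p - 1) * a := by
      rw [← Real.rpow_add_one ha.ne']; simp
    have : (1 + p * (b / a - 1)) * a ^ p = a ^ p - p * a ^ (p - 1) * (a - b) := by
      rw [e]; field_simp; ring
    linarith

/-! ### Harnack inequalities for bounded holomorphic functions -/

/-- A holomorphic function bounded by one varies on the concentric half ball by no more than twice
the distance of its central value to the unit circle. -/
theorem norm_sub_le_two_mul_one_sub_norm {F : ℂ → ℂ} {x y : ℂ} {r : ℝ} (hr : 0 < r)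
    (hF : DifferentiableOn ℂ F (ball x r)) (hb : ∀ z ∈ ball x r, ‖F z‖ ≤ 1)
    (hy : ‖y - x‖ ≤ r / 2) : ‖F y - F x‖ ≤ 2 * (1 - ‖F x‖) := by
  obtain ⟨u, hu, hux⟩ : ∃ u : ℂ, ‖u‖ = 1 ∧ u * F x = ‖F x‖ := by
    by_cases h : F x = 0
    · exact ⟨1, by simp [h]⟩
    · have h' : (‖F x‖ : ℂ) ≠ 0 := by simpa using h
      refine ⟨(starRingEnd ℂ) (F x) / ‖F x‖, by simp [h], ?_⟩
      rw [div_mul_eq_mul_div, mul_comm, Complex.mul_conj, Complex.normSq_eq_norm_sq]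
      field_simp
      norm_cast
  have hx1 : ‖F x‖ ≤ 1 := hb x (mem_ball_self hr)
  have hmem : ∀ t ∈ ball (0 : ℂ) r, x + t ∈ ball x r := fun t ht => by
    simpa [mem_ball, dist_eq_norm] using ht
  refine le_of_forall_pos_le_add fun ε hε => ?_
  -- After rotation by `u` the real part is at most `1 - ‖F x‖`. The extra `ε / 2` keeps the bound
  -- `M` positive when `‖F x‖ = 1`.
  have key := Complex.borelCaratheodory_zero (f := fun t => u * (F (x + t) - F x))
    (M := 1 - ‖F x‖ + ε / 2) (R := r) (z := y - x) (by linarith) ?_ ?_ hr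
    (by rw [mem_ball_zero_iff]; linarith) (by simp)
  · simp only [add_sub_cancel, norm_mul, hu, one_mul] at key
    refine key.trans ?_
    rw [div_le_iff₀ (by linarith)]
    nlinarith [norm_nonneg (y - x)]
  · refine DifferentiableOn.const_mul (DifferentiableOn.sub_const ?_ _) _
    exact hF.comp (by fun_prop) hmem
  · intro t ht
    have h1 : (u * F (x + t)).re ≤ 1 := by
      refine (Complex.re_le_norm _).trans ?_
      rw [norm_mul, hu, one_mul]
      exact hb _ (hmem t ht)
    have h2 : (u * (F (x + t) - F x)).re = (u * F (x + t)).re - ‖F x‖ := by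
      rw [mul_sub, hux]; simp
    change (u * (F (x + t) - F x)).re ≤ _
    rw [h2]; linarith

/-- Iteration of `norm_sub_le_two_mul_one_sub_norm` along a segment. -/
theorem norm_sub_le_pow_mul_one_sub_norm {F : ℂ → ℂ} {U : Set ℂ} {x y : ℂ} {r : ℝ} (hr : 0 < r)
    (hF : DifferentiableOn ℂ F U) (hb : ∀ z ∈ U, ‖F z‖ ≤ 1)
    (hU : ∀ t ∈ segment ℝ x y, ball t r ⊆ U) {N : ℕ} (hN : 0 < N) (hxy : ‖y - x‖ ≤ N * (r / 2)) :
    ‖F y - F x‖ ≤ (3 ^ N - 1) * (1 - ‖F x‖) := by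
  have hN' : (0 : ℝ) < N := by exact_mod_cast hN
  have key : ∀ k : ℕ, k ≤ N →
      ‖F (AffineMap.lineMap x y ((k : ℝ) / N)) - F x‖ ≤ (3 ^ k - 1) * (1 - ‖F x‖) := by
    intro k
    induction k with
    | zero => simp
    | succ k ih =>
      intro hk
      have ih := ih (by omega)
      set s := AffineMap.lineMap x y ((k : ℝ) / N) with hs
      set t := AffineMap.lineMap x y (((k + 1 : ℕ) : ℝ) / N) with ht
      have hsU : ball s r ⊆ U := by
        refine hU s ?_
        rw [segment_eq_image_lineMap]
        refine ⟨_, ⟨by positivity, ?_⟩, rfl⟩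
        rw [div_le_one hN']
        exact_mod_cast (by omega : k ≤ N)
      have hst : ‖t - s‖ ≤ r / 2 := by
        have : t - s = (1 / (N : ℝ)) • (y - x) := by
          rw [ht, hs, AffineMap.lineMap_apply_module', AffineMap.lineMap_apply_module',
            add_sub_add_right_eq_sub, ← sub_smul]
          congr 1
          push_cast
          ring
        rw [this, norm_smul, Real.norm_of_nonneg (by positivity), one_div,
          inv_mul_le_iff₀ hN']
        exact hxy
      have h1 := norm_sub_le_two_mul_one_sub_norm hr (hF.mono hsU) (fun z hz => hb z (hsU hz)) hst
      have h2 : ‖F t - F x‖ ≤ ‖F t - F s‖ + ‖F s - F x‖ := norm_sub_le_norm_sub_add_norm_sub _ _ _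
      have h3 : ‖F x‖ - ‖F s‖ ≤ ‖F s - F x‖ := by
        rw [norm_sub_rev]; exact norm_sub_norm_le _ _
      -- Since `1 - ‖F s‖ ≤ 3 ^ k * (1 - ‖F x‖)`, the new step costs at most `2 * 3 ^ k` times `1 -
      -- ‖F x‖`.
      rw [pow_succ]
      linarith
  have := key N le_rfl
  rwa [div_self hN'.ne', AffineMap.lineMap_apply_one] at this

/-- Harnack type inequality for holomorphic functions bounded by one on an annulus. -/
theorem exists_norm_sub_le_mul_one_sub_norm_of_annulus {a b : ℝ} (ha : 0 < a) (hab : a ≤ b)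
    (hb : b < 1) :
    ∃ C : ℝ, 0 < C ∧ ∀ F : ℂ → ℂ, DifferentiableOn ℂ F {z | a / 2 < ‖z‖ ∧ ‖z‖ < 1} →
      (∀ z ∈ {z : ℂ | a / 2 < ‖z‖ ∧ ‖z‖ < 1}, ‖F z‖ ≤ 1) →
      ∀ z z' : ℂ, a ≤ ‖z‖ → ‖z‖ ≤ b → a ≤ ‖z'‖ → ‖z'‖ ≤ b →
        ‖F z - F z'‖ ≤ C * (1 - ‖F z'‖) := by
  have hb0 : 0 < b := ha.trans_le hab
  have hlb : Real.log b < 0 := Real.log_neg hb0 hb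
  have hl2 : 0 < Real.log 2 := Real.log_pos (by norm_num)
  -- The exponential pulls the annulus back to a convex strip; `r` is the distance to its edges from
  -- the part over `a ≤ |z| ≤ b`.
  set r := min (Real.log 2) (-Real.log b) with hr
  have hr0 : 0 < r := lt_min hl2 (by linarith)
  obtain ⟨N, hN⟩ := exists_nat_ge (((Real.log b - Real.log a) + 2 * Real.pi) / (r / 2))
  rw [div_le_iff₀ (by positivity)] at hN
  refine ⟨3 ^ (N + 1) - 1, ?_, fun F hF hF1 z z' hz1 hz2 hz1' hz2' => ?_⟩
  · have : (1 : ℝ) < 3 ^ (N + 1) := one_lt_pow₀ (by norm_num) (by omega)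
    linarith
  set S : Set ℂ := {t | Real.log a - Real.log 2 < t.re ∧ t.re < 0} with hS
  have hmaps : MapsTo Complex.exp S {z | a / 2 < ‖z‖ ∧ ‖z‖ < 1} := by
    intro t ht
    simp only [mem_ofPred_eq, Complex.norm_exp]
    refine ⟨?_, by simpa using ht.2⟩
    rw [← Real.log_lt_iff_lt_exp (by positivity), Real.log_div ha.ne' (by norm_num)]
    exact ht.1
  have hz0 : z ≠ 0 := by rw [← norm_pos_iff]; linarith
  have hz0' : z' ≠ 0 := by rw [← norm_pos_iff]; linarith
  have l1 := Real.log_le_log ha hz1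
  have l2 := Real.log_le_log (ha.trans_le hz1) hz2
  have l1' := Real.log_le_log ha hz1'
  have l2' := Real.log_le_log (ha.trans_le hz1') hz2'
  have key := norm_sub_le_pow_mul_one_sub_norm (F := F ∘ Complex.exp) (U := S)
    (x := Complex.log z') (y := Complex.log z) hr0
    (hF.comp Complex.differentiable_exp.differentiableOn hmaps) (fun t ht => hF1 _ (hmaps ht))
    ?_ (Nat.succ_pos N) ?_
  · simpa [Complex.exp_log hz0, Complex.exp_log hz0'] using key
  · intro t ht s hs
    have hconv : Convex ℝ (Complex.re ⁻¹' Icc (Real.log a) (Real.log b)) :=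
      (convex_Icc _ _).is_linear_preimage Complex.reLm.isLinear
    have htm : t ∈ Complex.re ⁻¹' Icc (Real.log a) (Real.log b) :=
      hconv.segment_subset (by simp [Complex.log_re, l1', l2']) (by simp [Complex.log_re, l1, l2]) ht
    have hst : |s.re - t.re| < r := by
      rw [← Complex.sub_re]
      exact (Complex.abs_re_le_norm _).trans_lt (by simpa [dist_eq_norm] using hs)
    rw [abs_lt] at hst
    have h1 : r ≤ Real.log 2 := min_le_left _ _
    have h2 : r ≤ -Real.log b := min_le_right _ _
    exact ⟨by linarith [htm.1], by linarith [htm.2]⟩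
  · refine (Complex.norm_le_abs_re_add_abs_im _).trans ?_
    have h1 : |(Complex.log z - Complex.log z').re| ≤ Real.log b - Real.log a := by
      rw [Complex.sub_re, Complex.log_re, Complex.log_re, abs_le]
      constructor <;> linarith
    have h2 : |(Complex.log z - Complex.log z').im| ≤ 2 * Real.pi := by
      rw [Complex.sub_im, Complex.log_im, Complex.log_im, abs_le]
      constructor <;>
      linarith [Complex.neg_pi_lt_arg z, Complex.neg_pi_lt_arg z', Complex.arg_le_pi z,
        Complex.arg_le_pi z']
    push_cast
    linarith

/-! ### Removable singularities of the quotient -/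

/-- If `‖f‖ ≤ ‖g‖` and the zeros of `g` are isolated then `f / g` extends holomorphically. -/
theorem exists_differentiableOn_eq_mul_of_norm_le {f g : ℂ → ℂ} {U : Set ℂ} (hU : IsOpen U)
    (hf : DifferentiableOn ℂ f U) (hg : DifferentiableOn ℂ g U) (hfg : ∀ z ∈ U, ‖f z‖ ≤ ‖g z‖)
    (hg0 : ∀ z ∈ U, ∀ᶠ t in 𝓝[≠] z, g t ≠ 0) :
    ∃ F : ℂ → ℂ, DifferentiableOn ℂ F U ∧ (∀ z ∈ U, ‖F z‖ ≤ 1) ∧ ∀ z ∈ U, f z = F z * g z := by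
  have hq : ∀ z ∈ U, g z ≠ 0 → DifferentiableAt ℂ (f / g) z := fun z hz h =>
    (hf.differentiableAt (hU.mem_nhds hz)).div (hg.differentiableAt (hU.mem_nhds hz)) h
  have hq1 : ∀ z ∈ U, ‖(f / g) z‖ ≤ 1 := fun z hz => by
    rw [Pi.div_apply, norm_div]
    exact div_le_one_of_le₀ (hfg z hz) (norm_nonneg _)
  -- Punctured limits fill in all the singularities at once.
  set F : ℂ → ℂ := fun z => limUnder (𝓝[≠] z) (f / g) with hFdef
  have hFq : ∀ z ∈ U, g z ≠ 0 → F z = (f / g) z := fun z hz h =>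
    ((hq z hz h).continuousAt.tendsto.mono_left nhdsWithin_le_nhds).limUnder_eq
  have hloc : ∀ z ∈ U, DifferentiableAt ℂ F z := by
    intro z hz
    have hev : ∀ᶠ t in 𝓝 z, t ∈ U ∧ (t ≠ z → g t ≠ 0) :=
      Filter.Eventually.and (hU.mem_nhds hz) (eventually_nhdsWithin_iff.1 (hg0 z hz))
    set s := {t | t ∈ U ∧ (t ≠ z → g t ≠ 0)} with hs
    have hsz : s ∈ 𝓝 z := hev
    have hd := Complex.differentiableOn_update_limUnder_of_bddAbove (f := f / g) hsz
      (fun t ht => (hq t ht.1.1 (ht.1.2 ht.2)).differentiableWithinAt)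
      ⟨1, by rintro _ ⟨t, ht, rfl⟩; exact hq1 t ht.1.1⟩
    refine (hd.differentiableAt hsz).congr_of_eventuallyEq ?_
    filter_upwards [hsz] with t ht
    by_cases h : t = z
    · subst h; simp [hFdef]
    · rw [Function.update_of_ne h, hFq t ht.1 (ht.2 h)]
  refine ⟨F, fun z hz => (hloc z hz).differentiableWithinAt, fun z hz => ?_, fun z hz => ?_⟩
  · refine le_of_tendsto
      ((hloc z hz).continuousAt.norm.tendsto.mono_left (nhdsWithin_le_nhds (s := {z}ᶜ))) ?_
    filter_upwards [hg0 z hz, nhdsWithin_le_nhds (hU.mem_nhds hz)] with t ht htU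
    rw [hFq t htU ht]
    exact hq1 t htU
  · by_cases h : g z = 0
    · have := hfg z hz
      rw [h, norm_zero, norm_le_zero_iff] at this
      rw [h, this, mul_zero]
    · rw [hFq z hz h, Pi.div_apply, div_mul_cancel₀ _ h]

/-! ### Mean value estimates over an annulus -/

/-- Cauchy's estimate in `L¹` of a circle. -/
theorem two_pi_mul_norm_le_integral_circle {h : ℂ → ℂ} (hh : DifferentiableOn ℂ h (ball 0 1))
    {z t : ℂ} (ht0 : t ≠ 0) (ht : ‖t‖ < 1) (hz : ‖z‖ ≤ ‖t‖ / 2) :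
    2 * Real.pi * ‖h z‖ ≤
      ∫ θ in (0 : ℝ)..2 * Real.pi, 2 * ‖h ((Circle.exp θ : ℂ) * t)‖ := by
  have htp : 0 < ‖t‖ := norm_pos_iff.2 ht0
  obtain ⟨u, hu, hut⟩ : ∃ u : ℂ, ‖u‖ = 1 ∧ u * ‖t‖ = t := by
    have h' : (‖t‖ : ℂ) ≠ 0 := by simpa using ht0
    exact ⟨t / ‖t‖, by simp [ht0], by field_simp⟩
  have hu0 : u ≠ 0 := by rw [← norm_pos_iff, hu]; norm_num
  have hmaps : MapsTo (fun s => u * s) (ball (0 : ℂ) 1) (ball 0 1) := fun s hs => by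
    simpa [hu] using hs
  have hd : DifferentiableOn ℂ (fun s => h (u * s)) (ball 0 1) := hh.comp (by fun_prop) hmaps
  -- The Cauchy kernel `ζ / (ζ - w)` has modulus at most 2 when `|w| ≤ |ζ| / 2`.
  have hmean := DiffContOnCl.circleAverage_smul_div (f := fun s => h (u * s)) (c := 0)
    (R := ‖t‖) (w := u⁻¹ * z)
    (hd.diffContOnCl_ball (by rw [abs_of_pos htp]; exact closedBall_subset_ball ht))
    (by simp [hu]; linarith)
  simp only [mul_inv_cancel_left₀ hu0, Real.circleAverage_def, sub_zero] at hmean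
  rw [← hmean, norm_smul, Real.norm_of_nonneg (by positivity), mul_inv_cancel_left₀ (by positivity)]
  refine intervalIntegral.norm_integral_le_of_norm_le (by positivity) ?_ ?_
  · refine Eventually.of_forall fun θ _ => ?_
    have e : u * circleMap 0 ‖t‖ θ = (Circle.exp θ : ℂ) * t := by
      rw [← hut]
      simp [circleMap, hu]
      ring
    rw [norm_smul, e]
    gcongr
    have hn : ‖circleMap 0 ‖t‖ θ‖ = ‖t‖ := by simp
    have hz' : ‖u⁻¹ * z‖ ≤ ‖t‖ / 2 := by simpa [hu] using hz
    have := norm_sub_norm_le (circleMap 0 ‖t‖ θ) (u⁻¹ * z)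
    rw [norm_div, div_le_iff₀ (by linarith)]
    linarith
  · refine Continuous.intervalIntegrable ?_ _ _
    refine continuous_const.mul (Continuous.norm ?_)
    refine hh.continuousOn.comp_continuous (by fun_prop) fun θ => ?_
    simpa using ht

/-- A rotation invariant mean value estimate. -/
theorem measureReal_mul_norm_le_two_mul_setIntegral {μ : Measure ℂ} [IsFiniteMeasure μ]
    (hμ : ∀ u : Circle, MeasurePreserving (rotation u) μ μ) {a b : ℝ} (ha : 0 < a) (hb : b < 1)
    {h : ℂ → ℂ} (hh : DifferentiableOn ℂ h (ball 0 1)) {z : ℂ} (hz : ‖z‖ ≤ a / 2) :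
    μ.real {t | a ≤ ‖t‖ ∧ ‖t‖ ≤ b} * ‖h z‖ ≤ 2 * ∫ t in {t | a ≤ ‖t‖ ∧ ‖t‖ ≤ b}, ‖h t‖ ∂μ := by
  set K : Set ℂ := {t | a ≤ ‖t‖ ∧ ‖t‖ ≤ b} with hK
  have hKc : IsCompact K := by
    refine (isCompact_closedBall (0 : ℂ) b).of_isClosed_subset ?_ fun t ht => by simpa using ht.2
    exact (isClosed_le continuous_const continuous_norm).inter
      (isClosed_le continuous_norm continuous_const)
  have hKm : MeasurableSet K := hKc.measurableSet
  have h2pi : (0 : ℝ) ≤ 2 * Real.pi := by positivity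
  have hint : Integrable (fun q : ℂ × ℝ => 2 * ‖h ((Circle.exp q.2 : ℂ) * q.1)‖)
      ((μ.restrict K).prod (volume.restrict (Ioc 0 (2 * Real.pi)))) := by
    rw [Measure.prod_restrict]
    refine IntegrableOn.mono_set (t := K ×ˢ Icc 0 (2 * Real.pi)) ?_
      (prod_mono le_rfl Ioc_subset_Icc_self)
    refine ContinuousOn.integrableOn_compact (hKc.prod isCompact_Icc) ?_
    refine continuousOn_const.mul (ContinuousOn.norm ?_)
    refine hh.continuousOn.comp (by fun_prop) fun q hq => ?_
    have := hq.1.2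
    simp
    linarith
  have hrot : ∀ θ : ℝ, ∫ t in K, 2 * ‖h ((Circle.exp θ : ℂ) * t)‖ ∂μ
      = 2 * ∫ t in K, ‖h t‖ ∂μ := by
    intro θ
    have e : rotation (Circle.exp θ) ⁻¹' K = K := by
      ext t
      simp [hK]
    have := (hμ (Circle.exp θ)).setIntegral_preimage_emb
      (rotation (Circle.exp θ)).toHomeomorph.measurableEmbedding (fun t => ‖h t‖) K
    rw [e] at this
    rw [← this, ← integral_const_mul]
    rfl
  have hswap := integral_integral_swap (f := fun (t : ℂ) (θ : ℝ) =>
    2 * ‖h ((Circle.exp θ : ℂ) * t)‖) hint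
  simp only [hrot, integral_const, smul_eq_mul] at hswap
  have hmono : ∫ _ in K, 2 * Real.pi * ‖h z‖ ∂μ ≤
      ∫ t in K, (∫ θ in Ioc 0 (2 * Real.pi), 2 * ‖h ((Circle.exp θ : ℂ) * t)‖) ∂μ := by
    refine setIntegral_mono_on (integrable_const _) hint.integral_prod_left hKm fun t ht => ?_
    rw [← intervalIntegral.integral_of_le h2pi]
    refine two_pi_mul_norm_le_integral_circle hh ?_ (by linarith [ht.2]) (by linarith [ht.1])
    rw [← norm_pos_iff]
    linarith [ht.1]
  rw [hswap] at hmono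
  simp [Real.pi_pos.le] at hmono
  nlinarith [Real.pi_pos]

/-- Jensen's inequality raises the mean value estimate from exponent 1 to `p`. -/
theorem rpow_norm_le_two_rpow_mul_setAverage {μ : Measure ℂ} [IsFiniteMeasure μ]
    (hμ : ∀ u : Circle, MeasurePreserving (rotation u) μ μ) {a b p : ℝ} (hp : 1 ≤ p) (ha : 0 < a)
    (hb : b < 1) (hK0 : μ {t | a ≤ ‖t‖ ∧ ‖t‖ ≤ b} ≠ 0)
    {h : ℂ → ℂ} (hh : DifferentiableOn ℂ h (ball 0 1)) {z : ℂ} (hz : ‖z‖ ≤ a / 2) :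
    ‖h z‖ ^ p ≤ 2 ^ p * ⨍ t in {t | a ≤ ‖t‖ ∧ ‖t‖ ≤ b}, ‖h t‖ ^ p ∂μ := by
  have key := measureReal_mul_norm_le_two_mul_setIntegral hμ ha hb hh hz
  set K : Set ℂ := {t | a ≤ ‖t‖ ∧ ‖t‖ ≤ b} with hK
  have hKc : IsCompact K := by
    refine (isCompact_closedBall (0 : ℂ) b).of_isClosed_subset ?_ fun t ht => by simpa using ht.2
    exact (isClosed_le continuous_const continuous_norm).inter
      (isClosed_le continuous_norm continuous_const)
  have hcont : ContinuousOn (fun t => ‖h t‖) K :=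
    (hh.continuousOn.mono fun t ht => by simpa using ht.2.trans_lt hb).norm
  have hpos : 0 < μ.real K := measureReal_nonneg.lt_of_ne' (by rwa [measureReal_ne_zero_iff])
  have hJ := (convexOn_rpow hp).map_set_average_le (μ := μ) (t := K) (f := fun t => ‖h t‖)
    (continuousOn_id.rpow_const fun _ _ => Or.inr (by linarith)) isClosed_Ici hK0
    (measure_ne_top _ _) (Eventually.of_forall fun t => norm_nonneg _)
    (hcont.integrableOn_compact hKc)
    ((hcont.rpow_const fun _ _ => Or.inr (by linarith)).integrableOn_compact hKc)
  have h1 : ‖h z‖ ≤ 2 * ⨍ t in K, ‖h t‖ ∂μ := by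
    rw [setAverage_eq, smul_eq_mul, ← mul_assoc, mul_comm 2, mul_assoc, ← div_eq_inv_mul,
      le_div_iff₀ hpos]
    linarith
  have h0 : 0 ≤ ⨍ t in K, ‖h t‖ ∂μ := by
    rw [setAverage_eq]
    exact smul_nonneg (by positivity) (integral_nonneg fun _ => norm_nonneg _)
  calc ‖h z‖ ^ p ≤ (2 * ⨍ t in K, ‖h t‖ ∂μ) ^ p := by gcongr
    _ = 2 ^ p * (⨍ t in K, ‖h t‖ ∂μ) ^ p := Real.mul_rpow (by norm_num) h0
    _ ≤ _ := by gcongr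

/-! ### Choice of the annulus and of the small disk -/

/-- Countably many such annuli exhaust the punctured disk; the offset `n + 2` makes the inner radius
at most 1/2 and the outer one at least 1/2. -/
theorem exists_annulus_measure_ne_zero {μ : Measure ℂ} (hμ1 : μ (ball 0 1)ᶜ = 0)
    (hμ0 : μ {0} = 0) (hne : μ ≠ 0) :
    ∃ a b : ℝ, 0 < a ∧ a ≤ b ∧ b < 1 ∧ μ {t | a ≤ ‖t‖ ∧ ‖t‖ ≤ b} ≠ 0 := by
  by_contra! H
  apply hne
  rw [← Measure.measure_univ_eq_zero]
  refine measure_mono_null (t := ((ball 0 1)ᶜ ∪ {0}) ∪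
    ⋃ n : ℕ, {t : ℂ | 1 / ((n : ℝ) + 2) ≤ ‖t‖ ∧ ‖t‖ ≤ 1 - 1 / ((n : ℝ) + 2)}) ?_ ?_
  · intro t _
    by_cases h1 : t ∈ (ball (0 : ℂ) 1)ᶜ
    · exact Or.inl (Or.inl h1)
    by_cases h0 : t = 0
    · exact Or.inl (Or.inr h0)
    right
    have h1' : ‖t‖ < 1 := by simpa using h1
    have h0' : 0 < ‖t‖ := norm_pos_iff.2 h0
    obtain ⟨n, hn⟩ := exists_nat_one_div_lt (lt_min h0' (sub_pos.2 h1'))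
    have hn2 : 1 / ((n : ℝ) + 2) ≤ 1 / ((n : ℝ) + 1) := by gcongr; norm_num
    rw [lt_min_iff] at hn
    exact mem_iUnion.2 ⟨n, by linarith, by linarith⟩
  · refine measure_union_null (measure_union_null hμ1 hμ0) (measure_iUnion_null fun n => ?_)
    have hn : 1 / ((n : ℝ) + 2) ≤ 1 / 2 := by gcongr; simp
    have hn0 : 0 < 1 / ((n : ℝ) + 2) := by positivity
    exact H _ _ hn0 (by linarith) (by linarith)

theorem exists_small_ball_measureReal_le {μ : Measure ℂ} [IsFiniteMeasure μ] (hμ0 : μ {0} = 0)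
    {r ε : ℝ} (hr : 0 < r) (hε : 0 < ε) :
    ∃ c : ℝ, 0 < c ∧ c ≤ r ∧ μ.real (ball 0 c) ≤ ε := by
  have h := tendsto_measure_thickening_of_isClosed (μ := μ) (s := {(0 : ℂ)})
    ⟨1, one_pos, measure_ne_top _ _⟩ isClosed_singleton
  simp only [thickening_singleton, hμ0] at h
  have h1 : ∀ᶠ c in 𝓝[>] (0 : ℝ), μ (ball 0 c) < ENNReal.ofReal ε :=
    h.eventually_lt_const (by simpa using hε)
  have h2 : ∀ᶠ c in 𝓝[>] (0 : ℝ), c ∈ Ioc 0 r := Ioc_mem_nhdsGT hr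
  obtain ⟨c, hc1, hc2⟩ := (h1.and h2).exists
  exact ⟨c, hc2.1, hc2.2, ENNReal.toReal_le_of_le_ofReal hε.le hc1.le⟩

/-! ### Gain against loss -/

/-- The deviation of `‖f‖ ^ p` from `‖g‖ ^ p` near the origin, when `f` is close to `l * g` on an
annulus. -/
theorem rpow_norm_sub_rpow_norm_le {μ : Measure ℂ} [IsFiniteMeasure μ]
    (hμ : ∀ u : Circle, MeasurePreserving (rotation u) μ μ) {a b p : ℝ} (hp : 1 ≤ p) (ha : 0 < a)
    (hb : b < 1) (hK0 : μ {t | a ≤ ‖t‖ ∧ ‖t‖ ≤ b} ≠ 0) {f g : ℂ → ℂ}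
    (hf : DifferentiableOn ℂ f (ball 0 1)) (hg : DifferentiableOn ℂ g (ball 0 1))
    {l : ℂ} (hl : ‖l‖ ≤ 1) {η : ℝ} (hη : 0 ≤ η)
    (hfg : ∀ t ∈ {t : ℂ | a ≤ ‖t‖ ∧ ‖t‖ ≤ b}, ‖f t‖ ≤ ‖g t‖)
    (hlg : ∀ t ∈ {t : ℂ | a ≤ ‖t‖ ∧ ‖t‖ ≤ b}, ‖f t - l * g t‖ ≤ η * ‖g t‖)
    {z : ℂ} (hz : ‖z‖ ≤ a / 2) :
    ‖f z‖ ^ p - ‖g z‖ ^ p ≤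
      p * η * (2 ^ p * ⨍ t in {t | a ≤ ‖t‖ ∧ ‖t‖ ≤ b}, ‖g t‖ ^ p ∂μ) := by
  have hp0 : 0 < p := by linarith
  set K : Set ℂ := {t | a ≤ ‖t‖ ∧ ‖t‖ ≤ b} with hK
  have hKc : IsCompact K := by
    refine (isCompact_closedBall (0 : ℂ) b).of_isClosed_subset ?_ fun t ht => by simpa using ht.2
    exact (isClosed_le continuous_const continuous_norm).inter
      (isClosed_le continuous_norm continuous_const)
  have hh : DifferentiableOn ℂ (fun t => f t - l * g t) (ball 0 1) := hf.sub (hg.const_mul l)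
  have hI : ∀ {k : ℂ → ℂ}, DifferentiableOn ℂ k (ball 0 1) →
      IntegrableOn (fun t => ‖k t‖ ^ p) K μ := fun {k} hk =>
    ((hk.continuousOn.mono fun t ht => by simpa using ht.2.trans_lt hb).norm.rpow_const
      fun _ _ => Or.inr hp0.le).integrableOn_compact hKc
  -- Applied to `k = f` with `s = 1` and to `k = f - l * g` with `s = η`.
  have hbound : ∀ {k : ℂ → ℂ} {s : ℝ}, DifferentiableOn ℂ k (ball 0 1) → 0 ≤ s →
      (∀ t ∈ K, ‖k t‖ ≤ s * ‖g t‖) →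
      ‖k z‖ ≤ s * (2 * (⨍ t in K, ‖g t‖ ^ p ∂μ) ^ p⁻¹) := by
    intro k s hk hs hkg
    have h1 := rpow_norm_le_two_rpow_mul_setAverage hμ hp ha hb hK0 hk hz
    have h2 : ⨍ t in K, ‖k t‖ ^ p ∂μ ≤ s ^ p * ⨍ t in K, ‖g t‖ ^ p ∂μ := by
      rw [setAverage_eq, setAverage_eq, smul_eq_mul, smul_eq_mul, mul_left_comm,
        ← integral_const_mul (s ^ p)]
      refine mul_le_mul_of_nonneg_left ?_ (inv_nonneg.2 measureReal_nonneg)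
      refine setIntegral_mono_on (hI hk) ((hI hg).const_mul _) hKc.measurableSet fun t ht => ?_
      rw [← Real.mul_rpow hs (norm_nonneg _)]
      exact Real.rpow_le_rpow (norm_nonneg _) (hkg t ht) hp0.le
    have hG : 0 ≤ ⨍ t in K, ‖g t‖ ^ p ∂μ := by
      rw [setAverage_eq]
      exact smul_nonneg (by positivity) (integral_nonneg fun _ => by positivity)
    rw [← Real.rpow_le_rpow_iff (norm_nonneg _) (by positivity) hp0,
      Real.mul_rpow hs (by positivity), Real.mul_rpow (by norm_num) (by positivity),
      Real.rpow_inv_rpow hG hp0.ne']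
    refine h1.trans ?_
    rw [mul_left_comm]
    gcongr
  have hG : 0 ≤ ⨍ t in K, ‖g t‖ ^ p ∂μ := by
    rw [setAverage_eq]
    exact smul_nonneg (by positivity) (integral_nonneg fun _ => by positivity)
  have hfz := hbound hf zero_le_one (by simpa using hfg)
  have hhz := hbound hh hη hlg
  rw [one_mul] at hfz
  set Γ := 2 * (⨍ t in K, ‖g t‖ ^ p ∂μ) ^ p⁻¹ with hΓ
  have hΓ0 : 0 ≤ Γ := by positivity
  have hΓp : Γ ^ p = 2 ^ p * ⨍ t in K, ‖g t‖ ^ p ∂μ := by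
    rw [hΓ, Real.mul_rpow (by norm_num) (by positivity), Real.rpow_inv_rpow hG hp0.ne']
  have hlgz : ‖l * g z‖ ≤ ‖g z‖ := by
    rw [norm_mul]; exact mul_le_of_le_one_left (norm_nonneg _) hl
  calc ‖f z‖ ^ p - ‖g z‖ ^ p ≤ ‖f z‖ ^ p - ‖l * g z‖ ^ p := by gcongr
    _ ≤ p * ‖f z‖ ^ (p - 1) * (‖f z‖ - ‖l * g z‖) :=
      rpow_sub_rpow_le_mul_sub hp (norm_nonneg _) (norm_nonneg _)
    _ ≤ p * ‖f z‖ ^ (p - 1) * ‖f z - l * g z‖ := by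
      gcongr; exact norm_sub_norm_le _ _
    _ ≤ p * Γ ^ (p - 1) * (η * Γ) := by
      have : ‖f z‖ ^ (p - 1) ≤ Γ ^ (p - 1) :=
        Real.rpow_le_rpow (norm_nonneg _) hfz (by linarith)
      gcongr
    _ = p * η * (Γ ^ (p - 1) * Γ) := by ring
    _ = p * η * Γ ^ p := by
      rw [← Real.rpow_add_one' hΓ0 (by simpa using hp0.ne'), sub_add_cancel]
    _ = _ := by rw [hΓp]

/-- Korenblum's domination principle for finite rotation invariant measures on the disk. -/
theorem exists_radius_integral_rpow_norm_le {μ : Measure ℂ} [IsFiniteMeasure μ]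
    (hμ : ∀ u : Circle, MeasurePreserving (rotation u) μ μ) (hμ1 : μ (ball 0 1)ᶜ = 0)
    (hμ0 : μ {0} = 0) (hne : μ ≠ 0) {p : ℝ} (hp : 1 ≤ p) :
    ∃ c : ℝ, 0 < c ∧ c < 1 ∧ ∀ f g : ℂ → ℂ, DifferentiableOn ℂ f (ball 0 1) →
      DifferentiableOn ℂ g (ball 0 1) → Integrable (fun z => ‖f z‖ ^ p) μ →
      Integrable (fun z => ‖g z‖ ^ p) μ → (∀ z : ℂ, c ≤ ‖z‖ → ‖z‖ < 1 → ‖f z‖ ≤ ‖g z‖) →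
      ∫ z, ‖f z‖ ^ p ∂μ ≤ ∫ z, ‖g z‖ ^ p ∂μ := by
  have hp0 : 0 < p := by linarith
  obtain ⟨a, b, ha, hab, hb, hK0⟩ := exists_annulus_measure_ne_zero hμ1 hμ0 hne
  obtain ⟨C, hC, hHar⟩ := exists_norm_sub_le_mul_one_sub_norm_of_annulus ha hab hb
  set K : Set ℂ := {t | a ≤ ‖t‖ ∧ ‖t‖ ≤ b} with hK
  have hKm : MeasurableSet K := ((isClosed_le continuous_const continuous_norm).inter
      (isClosed_le continuous_norm continuous_const)).measurableSet
  have hKpos : 0 < μ.real K := measureReal_nonneg.lt_of_ne' (by rwa [measureReal_ne_zero_iff])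
  -- This `ε` is exactly the mass at which the loss bound equals the gain bound.
  obtain ⟨c, hc0, hca, hcμ⟩ := exists_small_ball_measureReal_le (μ := μ) hμ0 (half_pos ha)
    (ε := μ.real K / ((1 + C) * (p * C * 2 ^ p))) (by positivity)
  rw [le_div_iff₀ (by positivity)] at hcμ
  refine ⟨c, hc0, by linarith, fun f g hf hg hfi hgi hfg => ?_⟩
  have hae : ∀ᵐ z ∂μ, z ∈ ball (0 : ℂ) 1 := by
    rw [ae_iff]; exact hμ1
  have hgan : AnalyticOnNhd ℂ g (ball 0 1) := hg.analyticOnNhd isOpen_ball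
  have hfan : AnalyticOnNhd ℂ f (ball 0 1) := hf.analyticOnNhd isOpen_ball
  have hconn : IsPreconnected (ball (0 : ℂ) 1) := (convex_ball _ _).isPreconnected
  -- If `g` vanishes identically, so does `f` by the identity theorem; otherwise the zeros of `g`
  -- are isolated.
  by_cases hg0 : EqOn g 0 (ball 0 1)
  · have hopen : IsOpen {z : ℂ | c < ‖z‖ ∧ ‖z‖ < 1} :=
      (isOpen_lt continuous_const continuous_norm).inter
        (isOpen_lt continuous_norm continuous_const)
    have ha1 : ‖(a : ℂ)‖ = a := by simp [ha.le]
    have hamem : (a : ℂ) ∈ {z : ℂ | c < ‖z‖ ∧ ‖z‖ < 1} := by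
      simp only [mem_ofPred_eq, ha1]; constructor <;> linarith
    have hf0 : EqOn f 0 (ball 0 1) := by
      refine hfan.eqOn_zero_of_preconnected_of_eventuallyEq_zero hconn
        (z₀ := (a : ℂ)) (by simpa using hamem.2) ?_
      filter_upwards [hopen.mem_nhds hamem] with z hz
      have h := hfg z hz.1.le hz.2
      rw [hg0 (by simpa using hz.2)] at h
      simpa using h
    refine integral_mono_ae hfi hgi ?_
    filter_upwards [hae] with z hz
    rw [hf0 hz, hg0 hz]
  · have hgne : ∀ z ∈ ball (0 : ℂ) 1, ∀ᶠ t in 𝓝[≠] z, g t ≠ 0 := fun z hz =>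
      (hgan z hz).eventually_eq_zero_or_eventually_ne_zero.resolve_left fun h =>
        hg0 (hgan.eqOn_zero_of_preconnected_of_eventuallyEq_zero hconn hz h)
    set U : Set ℂ := {z | a / 2 < ‖z‖ ∧ ‖z‖ < 1} with hU
    have hUo : IsOpen U := (isOpen_lt continuous_const continuous_norm).inter
        (isOpen_lt continuous_norm continuous_const)
    have hUb : U ⊆ ball 0 1 := fun z hz => by simpa using hz.2
    obtain ⟨F, hFd, hF1, hF⟩ := exists_differentiableOn_eq_mul_of_norm_le hUo (hf.mono hUb)
      (hg.mono hUb) (fun z hz => hfg z (by linarith [hz.1]) hz.2) (fun z hz => hgne z (hUb hz))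
    have hKU : K ⊆ U := fun z hz => ⟨by linarith [hz.1], by linarith [hz.2]⟩
    have ha1 : ‖(a : ℂ)‖ = a := by simp [ha.le]
    have hamem : (a : ℂ) ∈ K := ⟨ha1.ge, by rw [ha1]; exact hab⟩
    set l := F a with hl
    set δ := 1 - ‖l‖ with hδ
    have hl1 : ‖l‖ ≤ 1 := hF1 _ (hKU hamem)
    have hδ0 : 0 ≤ δ := by linarith
    set G := ⨍ t in K, ‖g t‖ ^ p ∂μ with hGdef
    have hGK : ∫ t in K, ‖g t‖ ^ p ∂μ = μ.real K * G := by
      rw [hGdef, setAverage_eq, smul_eq_mul, mul_inv_cancel_left₀ hKpos.ne']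
    have hG0 : 0 ≤ G := by
      rw [hGdef, setAverage_eq]
      exact smul_nonneg (by positivity) (integral_nonneg fun _ => by positivity)
    have hin : ∀ z ∈ ball (0 : ℂ) c, -(p * (C * δ) * (2 ^ p * G)) ≤ ‖g z‖ ^ p - ‖f z‖ ^ p := by
      intro z hz
      have hz' : ‖z‖ < c := by simpa using hz
      have := rpow_norm_sub_rpow_norm_le hμ hp ha hb hK0 hf hg hl1 (η := C * δ) (by positivity)
        (fun t ht => hfg t (by linarith [ht.1]) (by linarith [ht.2])) (fun t ht => by
          rw [hF t (hKU ht), ← sub_mul, norm_mul]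
          gcongr
          exact hHar F hFd hF1 t a ht.1 ht.2 hamem.1 hamem.2) (z := z) (by linarith)
      linarith
    have hout : ∀ z ∈ K, δ / (1 + C) * ‖g z‖ ^ p ≤ ‖g z‖ ^ p - ‖f z‖ ^ p := by
      intro z hz
      -- Harnack based at `z` instead of `a` bounds `1 - ‖F z‖` from below.
      have h1 := hHar F hFd hF1 a z hamem.1 hamem.2 hz.1 hz.2
      have h2 : ‖F z‖ ≤ 1 := hF1 z (hKU hz)
      have h3 : ‖F z‖ - ‖l‖ ≤ ‖l - F z‖ := by rw [norm_sub_rev]; exact norm_sub_norm_le _ _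
      have h4 : δ / (1 + C) ≤ 1 - ‖F z‖ := by
        rw [div_le_iff₀ (by linarith)]
        linarith
      have h5 : ‖F z‖ ^ p ≤ ‖F z‖ := Real.rpow_le_self_of_le_one (norm_nonneg _) h2 hp
      rw [hF z (hKU hz), norm_mul, Real.mul_rpow (norm_nonneg _) (norm_nonneg _)]
      nlinarith [Real.rpow_nonneg (norm_nonneg (g z)) p]
    have hDi : Integrable (fun z => ‖g z‖ ^ p - ‖f z‖ ^ p) μ := hgi.sub hfi
    have hB : MeasurableSet (ball (0 : ℂ) c) := measurableSet_ball
    have hI1 : -(p * (C * δ) * (2 ^ p * G)) * μ.real (ball 0 c) ≤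
        ∫ z in ball 0 c, (‖g z‖ ^ p - ‖f z‖ ^ p) ∂μ := by
      have := setIntegral_mono_on (μ := μ) (f := fun _ => -(p * (C * δ) * (2 ^ p * G)))
        (integrable_const _).integrableOn hDi.integrableOn hB hin
      rw [setIntegral_const, smul_eq_mul, mul_comm] at this
      exact this
    have hI2 : δ / (1 + C) * (μ.real K * G) ≤ ∫ z in K, (‖g z‖ ^ p - ‖f z‖ ^ p) ∂μ := by
      rw [← hGK, ← integral_const_mul]
      exact setIntegral_mono_on (hgi.integrableOn.const_mul _) hDi.integrableOn hKm hout
    have hI3 : ∫ z in K, (‖g z‖ ^ p - ‖f z‖ ^ p) ∂μ ≤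
        ∫ z in (ball 0 c)ᶜ, (‖g z‖ ^ p - ‖f z‖ ^ p) ∂μ := by
      refine setIntegral_mono_set hDi.integrableOn ?_ ?_
      · rw [EventuallyLE, ae_restrict_iff' hB.compl]
        filter_upwards [hae] with z hz hzc
        have hz1 : ‖z‖ < 1 := by simpa using hz
        have hzc1 : c ≤ ‖z‖ := by simpa using hzc
        exact sub_nonneg.2 (Real.rpow_le_rpow (norm_nonneg _) (hfg z hzc1 hz1) hp0.le)
      · refine LE.le.eventuallyLE fun z hz => ?_
        have := hz.1
        simp
        linarith
    have hsum := integral_add_compl hB hDi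
    rw [integral_sub hgi hfi] at hsum
    have hfin : p * (C * δ) * (2 ^ p * G) * μ.real (ball 0 c) ≤
        δ / (1 + C) * (μ.real K * G) := by
      rw [div_mul_eq_mul_div, le_div_iff₀ (by linarith)]
      calc _ = δ * G * (μ.real (ball 0 c) * ((1 + C) * (p * C * 2 ^ p))) := by ring
        _ ≤ δ * G * μ.real K := by gcongr
        _ = _ := by ring
    linarith

/-! ### Radial weights -/

/-- The measure `w dA` of a radial weight is invariant under rotations. -/
theorem measurePreserving_rotation_withDensity_diskArea {w : ℂ → ℝ} (hrad : IsRadial w)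
    (u : Circle) :
    MeasurePreserving (rotation u) (diskArea.withDensity fun z => ENNReal.ofReal (w z))
      (diskArea.withDensity fun z => ENNReal.ofReal (w z)) := by
  have hemb : MeasurableEmbedding (rotation u) :=
    (rotation u).toHomeomorph.measurableEmbedding
  have hd : MeasurePreserving (rotation u) diskArea diskArea := by
    have h := (rotation u).measurePreserving.restrict_preimage (s := ball (0 : ℂ) 1)
      measurableSet_ball
    have e : rotation u ⁻¹' ball 0 1 = ball 0 1 := by ext z; rw [mem_preimage, mem_ball_zero_iff, mem_ball_zero_iff, LinearIsometryEquiv.norm_map]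
    rw [e] at h
    exact h.smul_measure _
  refine ⟨hemb.measurable, ?_⟩
  ext s hs
  rw [hemb.map_apply, withDensity_apply _ (hemb.measurable hs), withDensity_apply _ hs]
  refine Eq.trans ?_ (hd.setLIntegral_comp_preimage_emb hemb _ s)
  refine lintegral_congr_ae (ae_restrict_of_ae ?_)
  have hae : ∀ᵐ z ∂diskArea, z ∈ ball (0 : ℂ) 1 :=
    Measure.ae_smul_measure (ae_restrict_mem measurableSet_ball) _
  filter_upwards [hae] with z hz
  rw [hrad z hz, hrad (rotation u z) (by
    rwa [mem_ball_zero_iff, LinearIsometryEquiv.norm_map, ← mem_ball_zero_iff]),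
    LinearIsometryEquiv.norm_map]

theorem theorem1 (p : ℝ) (hp : 1 ≤ p) (w : ℂ → ℝ) (hw : IsWeight w)
    (hint : Integrable w diskArea) (hrad : IsRadial w) :
    KorenblumPrinciple p w := by
  set ρ : ℂ → ENNReal := fun z => ENNReal.ofReal (w z) with hρ
  set μ := diskArea.withDensity ρ with hμdef
  have hρm : AEMeasurable ρ diskArea := hw.aemeasurable.ennreal_ofReal
  have hρt : ∀ᵐ z ∂diskArea, ρ z < ⊤ := Eventually.of_forall fun _ => ENNReal.ofReal_lt_top
  have : IsFiniteMeasure μ := isFiniteMeasure_withDensity_ofReal hint.2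
  have hac : μ ≪ diskArea := withDensity_absolutelyContinuous _ _
  have hball : diskArea (ball 0 1)ᶜ = 0 := by
    simp [diskArea, Measure.restrict_apply measurableSet_ball.compl]
  have hzero : diskArea {(0 : ℂ)} = 0 := by
    simp [diskArea]
  have hne : μ ≠ 0 := by
    intro h
    have h1 : μ univ = 0 := by simp [h]
    rw [hμdef, withDensity_apply _ MeasurableSet.univ, setLIntegral_univ] at h1
    exact hw.lintegral_pos.ne' h1
  obtain ⟨c, hc0, hc1, hc⟩ := exists_radius_integral_rpow_norm_le (μ := μ)
    (measurePreserving_rotation_withDensity_diskArea hrad) (hac hball) (hac hzero) hne hp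
  -- `ENNReal.ofReal` truncates negative values, but `w` is nonnegative on the disk, which carries
  -- `diskArea`.
  have hsm : ∀ f : ℂ → ℂ, (fun z => (ρ z).toReal • ‖f z‖ ^ p) =ᵐ[diskArea]
      fun z => ‖f z‖ ^ p * w z := by
    intro f
    filter_upwards [(ae_iff.2 hball : ∀ᵐ z ∂diskArea, z ∈ ball (0 : ℂ) 1)] with z hz
    simp [hρ, ENNReal.toReal_ofReal (hw.nonneg z hz), mul_comm]
  have hI : ∀ f : ℂ → ℂ, ∫ z, ‖f z‖ ^ p * w z ∂diskArea = ∫ z, ‖f z‖ ^ p ∂μ := fun f => by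
    rw [hμdef, integral_withDensity_eq_integral_toReal_smul₀ hρm hρt, integral_congr_ae (hsm f)]
  have hIi : ∀ f : ℂ → ℂ, Integrable (fun z => ‖f z‖ ^ p * w z) diskArea →
      Integrable (fun z => ‖f z‖ ^ p) μ := fun f hf => by
    rw [hμdef, integrable_withDensity_iff_integrable_smul₀' hρm hρt]
    exact hf.congr (hsm f).symm
  refine ⟨c, hc0, hc1, fun f hf g hg hfg => ?_⟩
  rw [bergmanNorm, bergmanNorm, hI, hI]
  have h0 : 0 ≤ ∫ z, ‖f z‖ ^ p ∂μ := integral_nonneg fun _ => by positivity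
  exact Real.rpow_le_rpow h0 (hc f g hf.1 hg.1 (hIi f hf.2) (hIi g hg.2) hfg)
    (by positivity)
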